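/- Let $n\ge 2$, $N\ge 1$, let $B\subset\mathbb{R}^n$ be an open ball, let $1<p<\infty$, and let $f:B\times\mathbb{R}^{N\times n}\to[0,\infty)$ be such that $x\mapsto f(x,z)$ is (Lebesgue) measurable for every $z\in\mathbb{R}^{N\times n}$, $z\mapsto f(x,z)$ is strictly convex for every $x\in B$, and, for some constant $\tilde c>0$, $$\tilde c\,(|z|^p-1)\le f(x,z)\qquad\text{for all }x\in B,\ z\in\mathbb{R}^{N\times n}.$$ For $v\in W^{1,p}(B;\mathbb{R}^N)$ put $\mathcal F(v;B)=\int_B f(x,Dv(x))\,dx\in[0,\infty]$. Let $u\in W^{1,p}(B;\mathbb{R}^N)$ satisfy $\mathcal F(u;B)<+\infty$ and $$\mathcal F(u;B)=\inf_{v\in u+W^{1,p}_0(B;\mathbb{R}^N)}\mathcal F(v;B),$$ and let $Y$ be any subset of $W^{1,p}(B;\mathbb{R}^N)$. If the Lavrentiev phenomenon relative to $Y$ is absent, that is, if $$\inf_{v\in u+W^{1,p}_0(B;\mathbb{R}^N)}\mathcal F(v;B)=\inf_{v\in (u+W^{1,p}_0(B;\mathbb{R}^N))\cap Y}\mathcal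 F(v;B)$$ (with $\inf\emptyset=+\infty$), then there is energy approximation: there exists a sequence $(u_k)\subset Y$ such that $u_k\rightharpoonup u$ weakly in $W^{1,p}(B;\mathbb{R}^N)$ and $\mathcal F(u_k;B)\to\mathcal F(u;B)$. -/

import Mathlib

open MeasureTheory Set Filter Topology
open scoped ENNReal ContDiff

noncomputable section

namespace CalcVar

/-- The space `ℝⁿ` with its Euclidean norm. -/
abbrev Vec (n : ℕ) : Type := EuclideanSpace ℝ (Fin n)

/-- The space `ℝ^{N×n}` of `N × n` matrices `z = (z_{ij})` with the Euclidean norm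
`|z| = (∑ z_{ij}²)^{1/2}`. -/
abbrev Mat (N n : ℕ) : Type := EuclideanSpace ℝ (Fin N × Fin n)

/-- `φ` is a smooth function on `ℝⁿ` with compact support contained in `Ω`. -/
def IsTest {n : ℕ} {F : Type*} [NormedAddCommGroup F] [NormedSpace ℝ F]
    (Ω : Set (Vec n)) (φ : Vec n → F) : Prop :=
  ContDiff ℝ ∞ φ ∧ HasCompactSupport φ ∧ tsupport φ ⊆ Ω

/-- `G = (G_{ij})` is the weak gradient of `u = (u_i)` on the open set `Ω`:
`∫_Ω u_i ∂_j φ = - ∫_Ω G_{ij} φ` for all real-valued test functions `φ` on `Ω` and all `i`, `j`. -/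
def IsWeakGrad {n N : ℕ} (Ω : Set (Vec n)) (u : Vec n → Vec N) (G : Vec n → Mat N n) : Prop :=
  ∀ φ : Vec n → ℝ, IsTest Ω φ → ∀ (i : Fin N) (j : Fin n),
    ∫ x in Ω, u x i * fderiv ℝ φ x (EuclideanSpace.single j 1) = -∫ x in Ω, G x (i, j) * φ x

section helpers

variable {n N : ℕ} {Ω : Set (Vec n)} {p : ℝ≥0∞}

/-- A component of an `L^p` map times a continuous compactly supported function is integrable. -/
theorem integrable_comp_mul {ι : Type*} [Fintype ι] (hp : 1 ≤ p)
    (u : Lp (EuclideanSpace ℝ ι) p (volume.restrict Ω)) (i : ι)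
    {g : Vec n → ℝ} (hg : Continuous g) (hs : HasCompactSupport g) :
    Integrable (fun x => u x i * g x) (volume.restrict Ω) := by
  have h1 : LocallyIntegrable (fun x => u x) (volume.restrict Ω) := (Lp.memLp u).locallyIntegrable hp
  have h2 := h1.integrable_smul_left_of_hasCompactSupport hg hs
  have h3 := (EuclideanSpace.proj (𝕜 := ℝ) i).integrable_comp h2
  refine h3.congr (Eventually.of_forall fun x => ?_)
  simp [mul_comm]

theorem IsTest.integrable_mul {ι : Type*} [Fintype ι] {φ : Vec n → ℝ} (hφ : IsTest Ω φ)
    (hp : 1 ≤ p) (u : Lp (EuclideanSpace ℝ ι) p (volume.restrict Ω)) (i : ι) :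
    Integrable (fun x => u x i * φ x) (volume.restrict Ω) :=
  integrable_comp_mul hp u i hφ.1.continuous hφ.2.1

theorem IsTest.integrable_mul_fderiv {ι : Type*} [Fintype ι] {φ : Vec n → ℝ} (hφ : IsTest Ω φ)
    (hp : 1 ≤ p) (u : Lp (EuclideanSpace ℝ ι) p (volume.restrict Ω)) (i : ι) (v : Vec n) :
    Integrable (fun x => u x i * fderiv ℝ φ x v) (volume.restrict Ω) := by
  refine integrable_comp_mul hp u i ?_ ?_
  · exact (hφ.1.continuous_fderiv (by simp)).clm_apply continuous_const
  · exact (hφ.2.1.fderiv (𝕜 := ℝ)).comp_left (g := fun L : Vec n →L[ℝ] ℝ => L v) (by simp)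

end helpers

/-- The Sobolev space `W^{1,p}(Ω;ℝ^N)`, `Ω ⊆ ℝⁿ` open: the pairs `(u, Du)` where
`u ∈ L^p(Ω;ℝ^N)` has the weak gradient `Du ∈ L^p(Ω;ℝ^{N×n})`. As a subspace of the product
it carries the Sobolev norm `max (‖u‖_p, ‖Du‖_p)`. (The second component is determined
by the first, so this is the space of the functions `u`.) -/
def W1p {n : ℕ} (N : ℕ) (Ω : Set (Vec n)) (p : ℝ≥0∞) [hp : Fact (1 ≤ p)] :
    Submodule ℝ
      (Lp (Vec N) p (volume.restrict Ω) × Lp (Mat N n) p (volume.restrict Ω)) where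
  carrier := {w | IsWeakGrad Ω w.1 w.2}
  zero_mem' := by
    intro φ _ i j
    have h1 : (fun x => (0 : Lp (Vec N) p (volume.restrict Ω)) x i *
        fderiv ℝ φ x (EuclideanSpace.single j 1)) =ᵐ[volume.restrict Ω] fun _ => 0 := by
      filter_upwards [Lp.coeFn_zero (Vec N) p (volume.restrict Ω)] with x hx
      rw [hx]; simp
    have h2 : (fun x => (0 : Lp (Mat N n) p (volume.restrict Ω)) x (i, j) * φ x)
        =ᵐ[volume.restrict Ω] fun _ => 0 := by
      filter_upwards [Lp.coeFn_zero (Mat N n) p (volume.restrict Ω)] with x hx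
      rw [hx]; simp
    simp only [Prod.fst_zero, Prod.snd_zero]
    rw [integral_congr_ae h1, integral_congr_ae h2]
    simp
  add_mem' := by
    intro a b ha hb φ hφ i j
    have h1 : (fun x => (a.1 + b.1) x i * fderiv ℝ φ x (EuclideanSpace.single j 1))
        =ᵐ[volume.restrict Ω] fun x => a.1 x i * fderiv ℝ φ x (EuclideanSpace.single j 1)
          + b.1 x i * fderiv ℝ φ x (EuclideanSpace.single j 1) := by
      filter_upwards [Lp.coeFn_add a.1 b.1] with x hx
      rw [hx]; simp [add_mul]
    have h2 : (fun x => (a.2 + b.2) x (i, j) * φ x)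
        =ᵐ[volume.restrict Ω] fun x => a.2 x (i, j) * φ x + b.2 x (i, j) * φ x := by
      filter_upwards [Lp.coeFn_add a.2 b.2] with x hx
      rw [hx]; simp [add_mul]
    simp only [Prod.fst_add, Prod.snd_add]
    rw [integral_congr_ae h1, integral_congr_ae h2,
      integral_add (hφ.integrable_mul_fderiv hp.out a.1 i _)
        (hφ.integrable_mul_fderiv hp.out b.1 i _),
      integral_add (hφ.integrable_mul hp.out a.2 (i, j)) (hφ.integrable_mul hp.out b.2 (i, j)),
      ha φ hφ i j, hb φ hφ i j]
    ring
  smul_mem' := by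
    intro c a ha φ hφ i j
    have h1 : (fun x => (c • a.1) x i * fderiv ℝ φ x (EuclideanSpace.single j 1))
        =ᵐ[volume.restrict Ω]
          fun x => c * (a.1 x i * fderiv ℝ φ x (EuclideanSpace.single j 1)) := by
      filter_upwards [Lp.coeFn_smul c a.1] with x hx
      rw [hx]; simp [mul_assoc]
    have h2 : (fun x => (c • a.2) x (i, j) * φ x)
        =ᵐ[volume.restrict Ω] fun x => c * (a.2 x (i, j) * φ x) := by
      filter_upwards [Lp.coeFn_smul c a.2] with x hx
      rw [hx]; simp [mul_assoc]
    simp only [Prod.smul_fst, Prod.smul_snd]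
    rw [integral_congr_ae h1, integral_congr_ae h2, integral_const_mul, integral_const_mul,
      ha φ hφ i j]
    ring

/-- The subspace of `W^{1,p}(Ω;ℝ^N)` of (the classes of) the test functions
`φ ∈ C_c^∞(Ω;ℝ^N)`. -/
def testSubmodule {n : ℕ} (N : ℕ) (Ω : Set (Vec n)) (p : ℝ≥0∞) [Fact (1 ≤ p)] :
    Submodule ℝ (W1p N Ω p) where
  carrier := {w | ∃ φ : Vec n → Vec N, IsTest Ω φ ∧ w.1.1 =ᵐ[volume.restrict Ω] φ}
  zero_mem' := by
    refine ⟨fun _ => 0, ⟨contDiff_const, HasCompactSupport.zero, ?_⟩, ?_⟩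
    · have : tsupport (fun _ : Vec n => (0 : Vec N)) = ∅ := tsupport_eq_empty_iff.2 rfl
      rw [this]; exact empty_subset _
    · exact Lp.coeFn_zero (Vec N) p (volume.restrict Ω)
  add_mem' := by
    rintro a b ⟨φ, hφ, ha⟩ ⟨ψ, hψ, hb⟩
    refine ⟨φ + ψ, ⟨hφ.1.add hψ.1, hφ.2.1.add hψ.2.1, ?_⟩, ?_⟩
    · exact (tsupport_add φ ψ).trans (union_subset hφ.2.2 hψ.2.2)
    · exact (Lp.coeFn_add a.1.1 b.1.1).trans (ha.add hb)
  smul_mem' := by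
    rintro c a ⟨φ, hφ, ha⟩
    refine ⟨fun x => c • φ x, ⟨hφ.1.const_smul c, ?_, ?_⟩, ?_⟩
    · exact hφ.2.1.smul_left (f := fun _ => c)
    · exact (tsupport_smul_subset_right (fun _ => c) φ).trans hφ.2.2
    · exact (Lp.coeFn_smul c a.1.1).trans (ha.const_smul c)

/-- `W^{1,p}_0(Ω;ℝ^N)`: the closure of `C_c^∞(Ω;ℝ^N)` in `W^{1,p}(Ω;ℝ^N)`. -/
def W1p₀ {n : ℕ} (N : ℕ) (Ω : Set (Vec n)) (p : ℝ≥0∞) [Fact (1 ≤ p)] :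
    Submodule ℝ (W1p N Ω p) :=
  (testSubmodule N Ω p).topologicalClosure

/-- The Dirichlet class `u + W^{1,p}_0(Ω;ℝ^N)`. -/
def dirichletClass {n N : ℕ} {Ω : Set (Vec n)} {p : ℝ≥0∞} [Fact (1 ≤ p)] (u : W1p N Ω p) :
    Set (W1p N Ω p) :=
  {v | v - u ∈ W1p₀ N Ω p}

/-- The energy `𝓕(v;Ω) = ∫_Ω f(x, Dv(x)) dx ∈ [0,∞]` of a nonnegative density `f`. -/
def energy {n N : ℕ} {Ω : Set (Vec n)} {p : ℝ≥0∞} [Fact (1 ≤ p)]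
    (f : Vec n → Mat N n → ℝ) (v : W1p N Ω p) : ℝ≥0∞ :=
  ∫⁻ x in Ω, ENNReal.ofReal (f x (v.1.2 x))

/-- `v k ⇀ u` weakly in the real normed space `X`: `ℓ (v k) → ℓ u` for every continuous linear
functional `ℓ` on `X`. -/
def WeaklyConverges {X : Type*} [NormedAddCommGroup X] [NormedSpace ℝ X]
    (v : ℕ → X) (u : X) : Prop :=
  ∀ ℓ : X →L[ℝ] ℝ, Tendsto (fun k => ℓ (v k)) atTop (𝓝 (ℓ u))

/-- Absence of the Lavrentiev phenomenon relative to `Y`: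
`inf_{v ∈ u + W₀} 𝓕(v;Ω) = inf_{v ∈ (u + W₀) ∩ Y} 𝓕(v;Ω)`, where `W₀ = W^{1,p}_0(Ω;ℝ^N)`
and the infimum of the empty set is `∞`. -/
def NoLavrentiev {n N : ℕ} {Ω : Set (Vec n)} {p : ℝ≥0∞} [Fact (1 ≤ p)]
    (f : Vec n → Mat N n → ℝ) (u : W1p N Ω p) (Y : Set (W1p N Ω p)) : Prop :=
  (⨅ v ∈ dirichletClass u, energy f v) = ⨅ v ∈ dirichletClass u ∩ Y, energy f v

/-- Energy approximation of `u` by elements of `Y`. -/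
def EnergyApprox {n N : ℕ} {Ω : Set (Vec n)} {p : ℝ≥0∞} [Fact (1 ≤ p)]
    (f : Vec n → Mat N n → ℝ) (u : W1p N Ω p) (Y : Set (W1p N Ω p)) : Prop :=
  ∃ v : ℕ → W1p N Ω p, (∀ k, v k ∈ Y) ∧ WeaklyConverges v u ∧
    Tendsto (fun k => energy f (v k)) atTop (𝓝 (energy f u))

end CalcVar

end

/-! Absence of the Lavrentiev phenomenon supplies `v k` in the Dirichlet class and in `Y` with
energy below `energy f u + 2⁻¹ ^ k`; energies then converge, and the real issue is weak convergence
to `u` itself. Since the midpoint of `v k` and `u` is again a competitor, minimality of `u` bounds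
the integral of the midpoint convexity gap of `f x` by `2⁻¹ ^ k`. These bounds are summable, so the
gap tends to `0` almost everywhere for the whole sequence, and strict convexity turns this into `D(v
k) → Du` almost everywhere (`ae_tendsto_grad_of_minimizing`).

Coercivity bounds the gradients in `L^p`. For `p > 1`, boundedness and a.e. convergence give weak
convergence in `L^p` (`tendsto_clm_of_ae_tendsto_zero`), by an elementary summation argument using
neither reflexivity nor the dual of `L^p`. By Poincaré's inequality on `W1p₀` and Hahn–Banach, every
functional on `W^{1,p}` acts on the differences `v k - u` through their gradients alone, so weak
convergence of the gradients suffices. -/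

noncomputable section

namespace CalcVar

/-! ### Convexity gaps of strictly convex functions -/

section Convexity

variable {E : Type*} [NormedAddCommGroup E] [NormedSpace ℝ E]

/-- The midpoint convexity gap of a convex function is monotone along rays. -/
theorem _root_.ConvexOn.midpoint_gap_smul_le {f : E → ℝ} (hf : ConvexOn ℝ univ f) (z w : E) {t : ℝ}
    (ht0 : 0 ≤ t) (ht1 : t ≤ 1) :
    f (z + t • w) - 2 * f (z + (t / 2) • w) ≤ f (z + w) - 2 * f (z + (1 / 2 : ℝ) • w) := by
  have hpos : 0 < 2 - t := by linarith
  have hne : 2 - t ≠ 0 := hpos.ne'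
  -- Both `z + t • w` and `z + (1/2) • w` lie on the segment from `z + (t/2) • w` to `z + w`. In `h1
  -- + 2 * h2` the weights add up to exactly `1` at `z + w` and `2` at `z + (t/2) • w`.
  have h1 := hf.2 (mem_univ (z + w)) (mem_univ (z + (t / 2) • w))
    (show 0 ≤ t / (2 - t) by positivity)
    (show 0 ≤ (2 - 2 * t) / (2 - t) from div_nonneg (by linarith) hpos.le) (by field_simp; ring)
  have h2 := hf.2 (mem_univ (z + w)) (mem_univ (z + (t / 2) • w))
    (show 0 ≤ (1 - t) / (2 - t) from div_nonneg (by linarith) hpos.le)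
    (show 0 ≤ 1 / (2 - t) by positivity) (by field_simp; ring)
  have e1 : (t / (2 - t)) • (z + w) + ((2 - 2 * t) / (2 - t)) • (z + (t / 2) • w) = z + t • w := by
    match_scalars <;> field_simp <;> ring
  have e2 : ((1 - t) / (2 - t)) • (z + w) + (1 / (2 - t)) • (z + (t / 2) • w)
      = z + (1 / 2 : ℝ) • w := by
    match_scalars <;> field_simp <;> ring
  rw [e1] at h1
  rw [e2] at h2
  simp only [smul_eq_mul] at h1 h2
  have e3 : t / (2 - t) + 2 * ((1 - t) / (2 - t)) = 1 := by field_simp; ring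
  have e5 : (2 - 2 * t) / (2 - t) + 2 * (1 / (2 - t)) = 2 := by field_simp; ring
  have e6 : t / (2 - t) * f (z + w) + 2 * ((1 - t) / (2 - t) * f (z + w)) = f (z + w) := by
    linear_combination f (z + w) * e3
  have e7 : (2 - 2 * t) / (2 - t) * f (z + (t / 2) • w) + 2 * (1 / (2 - t) * f (z + (t / 2) • w))
      = 2 * f (z + (t / 2) • w) := by
    linear_combination f (z + (t / 2) • w) * e5
  linarith

theorem _root_.ConvexOn.midpoint_gap_nonneg {f : E → ℝ} (hf : ConvexOn ℝ univ f) (a b : E) :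
    0 ≤ 2⁻¹ * (f a + f b) - f ((2⁻¹ : ℝ) • (a + b)) := by
  have h := hf.2 (mem_univ a) (mem_univ b) (show (0 : ℝ) ≤ 2⁻¹ by norm_num)
    (show (0 : ℝ) ≤ 2⁻¹ by norm_num) (by norm_num)
  rw [← smul_add, smul_eq_mul, smul_eq_mul] at h
  linarith

variable [FiniteDimensional ℝ E]

/-- If the midpoint convexity gap of a strictly convex function between `z` and `z_k` tends to `0`,
then `z_k → z`. -/
theorem _root_.StrictConvexOn.tendsto_of_midpoint_gap {f : E → ℝ} (hf : StrictConvexOn ℝ univ f)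
    {z : E} {v : ℕ → E}
    (h : Tendsto (fun k => 2⁻¹ * (f (v k) + f z) - f ((2⁻¹ : ℝ) • (v k + z))) atTop (𝓝 0)) :
    Tendsto v atTop (𝓝 z) := by
  have hcont : Continuous f := continuousOn_univ.1 (hf.convexOn.continuousOn isOpen_univ)
  set φ : E → ℝ := fun w => 2⁻¹ * (f (z + w) + f z) - f (z + (1 / 2 : ℝ) • w) with hφ
  have hφc : Continuous φ := by fun_prop
  have hφpos : ∀ w, w ≠ 0 → 0 < φ w := by
    intro w hw
    have := hf.2 (mem_univ (z + w)) (mem_univ z) (by simpa using hw)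
      (show (0 : ℝ) < 2⁻¹ by norm_num) (show (0 : ℝ) < 2⁻¹ by norm_num) (by norm_num)
    have e : (2⁻¹ : ℝ) • (z + w) + (2⁻¹ : ℝ) • z = z + (1 / 2 : ℝ) • w := by
      match_scalars <;> norm_num
    rw [e] at this
    simp only [smul_eq_mul] at this
    simp only [hφ]
    linarith
  have hray : ∀ w (t : ℝ), 0 ≤ t → t ≤ 1 → φ (t • w) ≤ φ w := by
    intro w t h0 h1
    have := hf.convexOn.midpoint_gap_smul_le z w h0 h1
    simp only [hφ, smul_smul]
    rw [show 1 / 2 * t = t / 2 by ring]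
    linarith
  have hgap : ∀ k, 2⁻¹ * (f (v k) + f z) - f ((2⁻¹ : ℝ) • (v k + z)) = φ (v k - z) := by
    intro k
    simp only [hφ]
    congr 3
    · simp
    · match_scalars <;> norm_num
  simp only [hgap] at h
  rw [Metric.tendsto_atTop]
  intro ε hε
  by_contra! hcon
  obtain ⟨k₀, -, hk₀⟩ := hcon 0
  -- Points far from `z` are pulled back along rays to the compact sphere of radius `ε`, where `φ`
  -- has a positive minimum; the gap only decreases on the way, so it cannot tend to `0` along such
  -- points.
  have hscale : ∀ k, ε ≤ dist (v k) z →
      (ε / ‖v k - z‖) • (v k - z) ∈ Metric.sphere (0 : E) ε ∧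
        φ ((ε / ‖v k - z‖) • (v k - z)) ≤ φ (v k - z) := by
    intro k hk
    rw [dist_eq_norm] at hk
    have hpos : 0 < ‖v k - z‖ := hε.trans_le hk
    refine ⟨?_, hray _ _ (by positivity) ((div_le_one hpos).2 hk)⟩
    rw [mem_sphere_zero_iff_norm, norm_smul, Real.norm_of_nonneg (by positivity)]
    field_simp
  obtain ⟨y, hy, hymin⟩ := (isCompact_sphere (0 : E) ε).exists_isMinOn ⟨_, (hscale k₀ hk₀).1⟩
    hφc.continuousOn
  have hy0 : 0 < φ y := hφpos y (norm_ne_zero_iff.1 (by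
    rw [mem_sphere_zero_iff_norm.1 hy]; exact hε.ne'))
  obtain ⟨K, hK⟩ := eventually_atTop.1 (h.eventually (gt_mem_nhds hy0))
  obtain ⟨k, hkK, hk⟩ := hcon K
  have h1 := isMinOn_iff.1 hymin _ (hscale k hk).1
  have h2 := (hscale k hk).2
  have h3 := hK k hkK
  linarith

end Convexity

/-! ### Measurability of Carathéodory compositions -/

/-- A Carathéodory function composed with a strongly measurable map is measurable. -/
theorem aemeasurable_caratheodory {α E : Type*} [MeasurableSpace α] {μ : Measure α}
    [TopologicalSpace E] [TopologicalSpace.PseudoMetrizableSpace E] [MeasurableSpace E] [BorelSpace E]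
    {f : α → E → ℝ}
    (hmeas : ∀ z, AEMeasurable (fun x => f x z) μ) (hcont : ∀ᵐ x ∂μ, Continuous (f x))
    {G : α → E} (hG : AEStronglyMeasurable G μ) : AEMeasurable (fun x => f x (G x)) μ := by
  -- For a simple map only finitely many slices `f · z` occur, each on a measurable level set.
  -- Continuity in `z` then carries measurability to limits of simple maps.
  have hs : ∀ s : SimpleFunc α E, AEMeasurable (fun x => f x (s x)) μ := by
    intro s
    have : (fun x => f x (s x)) =
        ∑ z ∈ s.range, (s ⁻¹' {z}).indicator (fun x => f x z) := by
      ext x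
      rw [Finset.sum_apply, Finset.sum_eq_single (s x)]
      · simp
      · intro z _ hz
        exact indicator_of_notMem (by simpa using hz.symm) _
      · intro h
        exact absurd (s.mem_range_self x) h
    rw [this]
    exact Finset.aemeasurable_sum _ fun z _ => (hmeas z).indicator (s.measurableSet_fiber z)
  have hlim : AEMeasurable (fun x => f x (hG.mk G x)) μ := by
    refine aemeasurable_of_tendsto_metrizable_ae'
      (fun k => hs (hG.stronglyMeasurable_mk.approx k)) ?_
    filter_upwards [hcont] with x hx
    exact (hx.tendsto _).comp (hG.stronglyMeasurable_mk.tendsto_approx x)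
  refine hlim.congr ?_
  filter_upwards [hG.ae_eq_mk] with x hx
  rw [hx]

/-! ### Weak convergence in `L^p` from boundedness and a.e. convergence -/

section Weak

variable {α E : Type*} [MeasurableSpace α] {μ : Measure α} [NormedAddCommGroup E]
  {p : ℝ≥0∞} [Fact (1 ≤ p)]

theorem lintegral_rpow_enorm_eq (hp : p ≠ ⊤) (s : Lp E p μ) :
    ∫⁻ x, ‖s x‖ₑ ^ p.toReal ∂μ = ‖s‖ₑ ^ p.toReal := by
  have hp0 : p ≠ 0 := (zero_lt_one.trans_le (Fact.out : 1 ≤ p)).ne'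
  have : 0 < p.toReal := ENNReal.toReal_pos hp0 hp
  rw [Lp.enorm_def, eLpNorm_eq_lintegral_rpow_enorm_toReal hp0 hp, ← ENNReal.rpow_mul,
    one_div_mul_cancel this.ne', ENNReal.rpow_one]

/-- Asymptotic almost additivity of the `p`-th power of the norm under a.e. convergence to `0`. -/
theorem eventually_enorm_add_rpow_le (hp : p ≠ ⊤) (s : Lp E p μ) {g : ℕ → Lp E p μ} {C : ℝ≥0∞}
    (hC : ∀ k, ‖g k‖ₑ ≤ C) (hae : ∀ᵐ x ∂μ, Tendsto (fun k => g k x) atTop (𝓝 0)) :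
    ∀ᶠ k in atTop, ‖s + g k‖ₑ ^ p.toReal ≤
      ‖s‖ₑ ^ p.toReal + (1 + 2 ^ (p.toReal - 1) * C ^ p.toReal) := by
  have hp0 : p ≠ 0 := (zero_lt_one.trans_le (Fact.out : 1 ≤ p)).ne'
  have hq : 0 < p.toReal := ENNReal.toReal_pos hp0 hp
  have hq1 : 1 ≤ p.toReal := by
    simpa using ENNReal.toReal_mono hp (Fact.out : 1 ≤ p)
  have hcoef : (2 : ℝ≥0∞) ^ (p.toReal - 1) ≠ ⊤ :=
    ENNReal.rpow_ne_top_of_nonneg (by linarith) (by simp)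
  have hm : ∀ t : Lp E p μ, AEMeasurable (fun x => ‖t x‖ₑ ^ p.toReal) μ := fun t =>
    (Lp.aestronglyMeasurable t).enorm.pow_const _
  -- The truncated difference is dominated by `2 ^ (p - 1) * ‖s x‖ₑ ^ p`, independently of `k`, and
  -- tends to `‖s x‖ₑ ^ p`. What was subtracted has integral controlled by `C`, so the final error
  -- does not depend on `s`.
  set F : ℕ → α → ℝ≥0∞ := fun k x =>
    ‖(s + g k) x‖ₑ ^ p.toReal - 2 ^ (p.toReal - 1) * ‖g k x‖ₑ ^ p.toReal
  have hlim : Tendsto (fun k => ∫⁻ x, F k x ∂μ) atTop (𝓝 (∫⁻ x, ‖s x‖ₑ ^ p.toReal ∂μ)) := by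
    refine tendsto_lintegral_of_dominated_convergence'
      (fun x => 2 ^ (p.toReal - 1) * ‖s x‖ₑ ^ p.toReal) ?_ ?_ ?_ ?_
    · intro k
      exact (hm _).sub ((hm _).const_mul _)
    · intro k
      filter_upwards [Lp.coeFn_add s (g k)] with x hx
      simp only [F, hx, Pi.add_apply]
      rw [tsub_le_iff_right, ← mul_add]
      exact (ENNReal.rpow_le_rpow (enorm_add_le _ _) hq.le).trans
        (ENNReal.rpow_add_le_mul_rpow_add_rpow _ _ hq1)
    · rw [lintegral_const_mul' _ _ hcoef, lintegral_rpow_enorm_eq hp]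
      exact ENNReal.mul_ne_top hcoef (ENNReal.rpow_ne_top_of_nonneg hq.le enorm_ne_top)
    · have hadd : ∀ᵐ x ∂μ, ∀ k, (s + g k) x = s x + g k x := by
        rw [ae_all_iff]; exact fun k => Lp.coeFn_add s (g k)
      filter_upwards [hadd, hae] with x hx hgx
      simp only [F, hx]
      have h1 : Tendsto (fun k => ‖s x + g k x‖ₑ ^ p.toReal) atTop (𝓝 (‖s x‖ₑ ^ p.toReal)) := by
        have : Tendsto (fun k => s x + g k x) atTop (𝓝 (s x)) := by
          simpa using hgx.const_add (s x)
        exact (ENNReal.continuous_rpow_const.tendsto _).comp this.enorm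
      have h2 : Tendsto (fun k => 2 ^ (p.toReal - 1) * ‖g k x‖ₑ ^ p.toReal) atTop (𝓝 0) := by
        have : Tendsto (fun k => ‖g k x‖ₑ ^ p.toReal) atTop (𝓝 0) := by
          have := (ENNReal.continuous_rpow_const (y := p.toReal)).tendsto _ |>.comp hgx.enorm
          simpa [ENNReal.zero_rpow_of_pos hq, Function.comp_def] using this
        simpa using ENNReal.Tendsto.const_mul this (Or.inr hcoef)
      simpa using ENNReal.Tendsto.sub h1 h2 (Or.inr (by simp))
  rw [lintegral_rpow_enorm_eq hp] at hlim
  have hlt : ‖s‖ₑ ^ p.toReal < ‖s‖ₑ ^ p.toReal + 1 :=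
    ENNReal.lt_add_right (ENNReal.rpow_ne_top_of_nonneg hq.le enorm_ne_top) (by simp)
  filter_upwards [hlim.eventually (gt_mem_nhds hlt)] with k hk
  calc ‖s + g k‖ₑ ^ p.toReal = ∫⁻ x, ‖(s + g k) x‖ₑ ^ p.toReal ∂μ :=
        (lintegral_rpow_enorm_eq hp _).symm
    _ ≤ ∫⁻ x, (F k x + 2 ^ (p.toReal - 1) * ‖g k x‖ₑ ^ p.toReal) ∂μ :=
        lintegral_mono fun x => le_tsub_add
    _ = ∫⁻ x, F k x ∂μ + 2 ^ (p.toReal - 1) * ‖g k‖ₑ ^ p.toReal := by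
        rw [lintegral_add_right' _ ((hm _).const_mul _), lintegral_const_mul' _ _ hcoef,
          lintegral_rpow_enorm_eq hp]
    _ ≤ (‖s‖ₑ ^ p.toReal + 1) + 2 ^ (p.toReal - 1) * C ^ p.toReal := by
        gcongr
        exact hC k
    _ = _ := by rw [add_assoc]

variable [NormedSpace ℝ E]

/-- A bounded sequence in `L^p`, `1 < p < ∞`, that converges to `0` almost everywhere converges
to `0` weakly. -/
theorem tendsto_clm_of_ae_tendsto_zero (hp1 : 1 < p) (hp : p ≠ ⊤) {g : ℕ → Lp E p μ} {C : ℝ}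
    (hC : ∀ k, ‖g k‖ ≤ C) (hae : ∀ᵐ x ∂μ, Tendsto (fun k => g k x) atTop (𝓝 0))
    (ℓ : Lp E p μ →L[ℝ] ℝ) : Tendsto (fun k => ℓ (g k)) atTop (𝓝 0) := by
  have hq1 : 1 < p.toReal := by
    simpa using (ENNReal.toReal_lt_toReal (by simp) hp).2 hp1
  have hq : 0 < p.toReal := zero_lt_one.trans hq1
  by_contra hnot
  rw [Metric.tendsto_atTop] at hnot
  push Not at hnot
  obtain ⟨ε, hε, hfreq⟩ := hnot
  have hCe : ∀ k, ‖g k‖ₑ ≤ ENNReal.ofReal C := fun k => by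
    rw [← ofReal_norm]; exact ENNReal.ofReal_le_ofReal (hC k)
  have hae' : ∀ᵐ x ∂μ, Tendsto (fun k => (-g k) x) atTop (𝓝 0) := by
    have hneg : ∀ᵐ x ∂μ, ∀ k, (-g k) x = -g k x := by
      rw [ae_all_iff]; exact fun k => Lp.coeFn_neg (g k)
    filter_upwards [hae, hneg] with x hx hn
    simp only [hn]
    simpa using hx.neg
  set D : ℝ≥0∞ := 1 + 2 ^ (p.toReal - 1) * ENNReal.ofReal C ^ p.toReal with hD
  have hDtop : D ≠ ⊤ := by
    refine ENNReal.add_ne_top.2 ⟨by simp, ENNReal.mul_ne_top ?_ ?_⟩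
    · exact ENNReal.rpow_ne_top_of_nonneg (by linarith) (by simp)
    · exact ENNReal.rpow_ne_top_of_nonneg hq.le (by simp)
  -- A sum of `m` well-chosen terms `±g k`: `ℓ` grows at least like `m`, while the norm grows at
  -- most like `m ^ (1/p)`, because each new term costs the same `D` in the `p`-th power. For `p >
  -- 1` this contradicts boundedness of `ℓ`.
  have hsum : ∀ m : ℕ, ∃ s : Lp E p μ, ‖s‖ₑ ^ p.toReal ≤ m * D ∧ m * ε ≤ ℓ s := by
    intro m
    induction m with
    | zero => exact ⟨0, by simp [ENNReal.zero_rpow_of_pos hq], by simp⟩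
    | succ m ih =>
      obtain ⟨s, hs, hℓ⟩ := ih
      have e1 := eventually_enorm_add_rpow_le hp s hCe hae
      have e2 := eventually_enorm_add_rpow_le hp s (g := fun k => -g k)
        (fun k => by simpa using hCe k) hae'
      obtain ⟨K, hK⟩ := eventually_atTop.1 (e1.and e2)
      obtain ⟨k, hkK, hk⟩ := hfreq K
      rw [Real.dist_eq, sub_zero] at hk
      have hle : ∀ a : ℝ≥0∞, a ≤ ‖s‖ₑ ^ p.toReal + D → a ≤ ((m + 1 : ℕ) : ℝ≥0∞) * D := by
        intro a ha
        push_cast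
        rw [add_mul, one_mul]
        exact ha.trans (by gcongr)
      -- The sign of the new term is chosen so that it adds at least `ε` to `ℓ`.
      rcases le_abs.1 hk with h | h
      · refine ⟨s + g k, hle _ (hK k hkK).1, ?_⟩
        rw [map_add]; push_cast; linarith
      · refine ⟨s + -g k, hle _ (hK k hkK).2, ?_⟩
        rw [map_add, map_neg]; push_cast; linarith
  have hbound : ∀ m : ℕ, (m * ε) ^ p.toReal ≤ ‖ℓ‖ ^ p.toReal * (m * D.toReal) := by
    intro m
    obtain ⟨s, hs, hℓ⟩ := hsum m
    have h1 : ‖s‖ ^ p.toReal ≤ m * D.toReal := by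
      have := ENNReal.toReal_mono (ENNReal.mul_ne_top (by simp) hDtop) hs
      simpa [← ENNReal.toReal_rpow] using this
    calc (m * ε) ^ p.toReal ≤ (‖ℓ‖ * ‖s‖) ^ p.toReal := by
          refine Real.rpow_le_rpow (by positivity) ?_ hq.le
          exact hℓ.trans ((le_abs_self _).trans (ℓ.le_opNorm s))
      _ = ‖ℓ‖ ^ p.toReal * ‖s‖ ^ p.toReal := Real.mul_rpow (norm_nonneg _) (norm_nonneg _)
      _ ≤ _ := by gcongr
  have hgrow : Tendsto (fun m : ℕ => (m : ℝ) ^ (p.toReal - 1)) atTop atTop :=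
    (tendsto_rpow_atTop (by linarith)).comp tendsto_natCast_atTop_atTop
  obtain ⟨m, hm, hm0⟩ := ((hgrow.eventually_gt_atTop (‖ℓ‖ ^ p.toReal * D.toReal / ε ^ p.toReal)).and
    (eventually_gt_atTop 0)).exists
  have hm0' : (0 : ℝ) < m := by exact_mod_cast hm0
  have hεq : 0 < ε ^ p.toReal := Real.rpow_pos_of_pos hε _
  rw [div_lt_iff₀ hεq] at hm
  have h2 := hbound m
  rw [Real.mul_rpow hm0'.le hε.le] at h2
  have h3 : (m : ℝ) ^ p.toReal = m * m ^ (p.toReal - 1) := by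
    rw [Real.rpow_sub_one hm0'.ne']; field_simp
  rw [h3] at h2
  nlinarith

end Weak

/-! ### Poincaré's inequality on a ball -/

section Poincare

variable {n N : ℕ}

/-- The weak gradient of a test function is its classical gradient. -/
theorem weakGrad_ae_eq_fderiv {Ω : Set (Vec n)} (hΩ : IsOpen Ω) {p : ℝ≥0∞} [hp : Fact (1 ≤ p)]
    (w : W1p N Ω p) {φ : Vec n → Vec N} (hφ : IsTest Ω φ)
    (hw : w.1.1 =ᵐ[volume.restrict Ω] φ) (i : Fin N) (j : Fin n) :
    ∀ᵐ x ∂(volume.restrict Ω),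
      w.1.2 x (i, j) = fderiv ℝ φ x (EuclideanSpace.single j 1) i := by
  have hφi : ContDiff ℝ ∞ (fun x => φ x i) := (EuclideanSpace.proj (𝕜 := ℝ) i).contDiff.comp hφ.1
  have hd : ∀ x, fderiv ℝ (fun x => φ x i) x (EuclideanSpace.single j 1)
      = fderiv ℝ φ x (EuclideanSpace.single j 1) i := by
    intro x
    have h1 : HasFDerivAt φ (fderiv ℝ φ x) x := (hφ.1.differentiable (by simp) x).hasFDerivAt
    have h2 := (EuclideanSpace.proj (𝕜 := ℝ) i).hasFDerivAt.comp x h1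
    have h3 : fderiv ℝ (fun x => φ x i) x = (EuclideanSpace.proj (𝕜 := ℝ) i).comp (fderiv ℝ φ x) :=
      h2.fderiv
    rw [h3]; rfl
  have hdc : Continuous fun x => fderiv ℝ (fun x => φ x i) x (EuclideanSpace.single j (1 : ℝ)) :=
    (hφi.continuous_fderiv (by simp)).clm_apply continuous_const
  have hG : LocallyIntegrable (fun x => w.1.2 x (i, j)) (volume.restrict Ω) := by
    have h1 : LocallyIntegrable (fun x => w.1.2 x) (volume.restrict Ω) :=
      (Lp.memLp w.1.2).locallyIntegrable hp.out
    intro x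
    obtain ⟨s, hs, hi⟩ := h1 x
    exact ⟨s, hs, (EuclideanSpace.proj (𝕜 := ℝ) (i, j)).integrable_comp hi⟩
  -- Uniqueness of weak gradients: by the fundamental lemma it is enough to test the difference
  -- against smooth `g`, where integration by parts for `φ` cancels the weak identity for `w`.
  have key := hΩ.ae_eq_zero_of_integral_contDiff_smul_eq_zero (μ := volume.restrict Ω)
    (f := fun x => w.1.2 x (i, j) - fderiv ℝ (fun x => φ x i) x (EuclideanSpace.single j 1))
    ((hG.sub hdc.locallyIntegrable).locallyIntegrableOn Ω) ?_
  · filter_upwards [key, ae_restrict_mem hΩ.measurableSet] with x hx hxΩ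
    rw [← hd]
    exact sub_eq_zero.1 (hx hxΩ)
  intro g hg hgs hgΩ
  have htest : IsTest Ω g := ⟨hg, hgs, hgΩ⟩
  have hgc : Continuous g := hg.continuous
  have hgd : Continuous fun x => fderiv ℝ g x (EuclideanSpace.single j (1 : ℝ)) :=
    (hg.continuous_fderiv (by simp)).clm_apply continuous_const
  have hgds : HasCompactSupport fun x => fderiv ℝ g x (EuclideanSpace.single j (1 : ℝ)) :=
    (hgs.fderiv (𝕜 := ℝ)).comp_left (g := fun L : Vec n →L[ℝ] ℝ => L _) (by simp)
  have hg0 : ∀ x, x ∉ Ω → g x = 0 := fun x hx =>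
    image_eq_zero_of_notMem_tsupport fun h => hx (hgΩ h)
  have hgd0 : ∀ x, x ∉ Ω → fderiv ℝ g x (EuclideanSpace.single j (1 : ℝ)) = 0 := fun x hx => by
    have : fderiv ℝ g x = 0 := image_eq_zero_of_notMem_tsupport fun h =>
      hx (hgΩ (tsupport_fderiv_subset ℝ h))
    rw [this]; rfl
  have i1 : Integrable (fun x => w.1.2 x (i, j) * g x) (volume.restrict Ω) :=
    htest.integrable_mul hp.out w.1.2 (i, j)
  have i2 : Integrable
      (fun x => fderiv ℝ (fun x => φ x i) x (EuclideanSpace.single j (1 : ℝ)) * g x) :=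
    (hdc.mul hgc).integrable_of_hasCompactSupport hgs.mul_left
  have i3 : Integrable
      (fun x => φ x i * fderiv ℝ g x (EuclideanSpace.single j (1 : ℝ))) :=
    (hφi.continuous.mul hgd).integrable_of_hasCompactSupport hgds.mul_left
  have i4 : Integrable (fun x => φ x i * g x) :=
    (hφi.continuous.mul hgc).integrable_of_hasCompactSupport hgs.mul_left
  have hparts := integral_mul_fderiv_eq_neg_fderiv_mul_of_integrable i2 i3 i4
    (fun x _ => hφi.differentiable (by simp) x) (fun x _ => hg.differentiable (by simp) x)
  have hweak := w.2 g htest i j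
  have hcongr : ∫ x in Ω, w.1.1 x i * fderiv ℝ g x (EuclideanSpace.single j 1)
      = ∫ x in Ω, φ x i * fderiv ℝ g x (EuclideanSpace.single j 1) := by
    refine integral_congr_ae ?_
    filter_upwards [hw] with x hx
    rw [hx]
  rw [hcongr, setIntegral_eq_integral_of_forall_compl_eq_zero
    (fun x hx => by rw [hgd0 x hx, mul_zero]), hparts] at hweak
  have hr : ∫ x in Ω, fderiv ℝ (fun x => φ x i) x (EuclideanSpace.single j 1) * g x
      = ∫ x, fderiv ℝ (fun x => φ x i) x (EuclideanSpace.single j 1) * g x :=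
    setIntegral_eq_integral_of_forall_compl_eq_zero (fun x hx => by rw [hg0 x hx, mul_zero])
  have : (fun x => g x • (w.1.2 x (i, j) -
      fderiv ℝ (fun x => φ x i) x (EuclideanSpace.single j 1)))
      = fun x => w.1.2 x (i, j) * g x -
        fderiv ℝ (fun x => φ x i) x (EuclideanSpace.single j 1) * g x := by
    ext x; simp only [smul_eq_mul]; ring
  rw [this, integral_sub i1 i2.restrict, hr]
  linarith

/-- A continuously differentiable function that vanishes at `x + L • e` is bounded at `x` by
the integral of its derivative along the segment. -/
theorem enorm_le_lintegral_fderiv {E F : Type*} [NormedAddCommGroup E] [NormedSpace ℝ E]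
    [NormedAddCommGroup F] [NormedSpace ℝ F] [CompleteSpace F] {φ : E → F} (hφ : ContDiff ℝ 1 φ)
    (x e : E) {L : ℝ} (hL : 0 ≤ L) (h0 : φ (x + L • e) = 0) :
    ‖φ x‖ₑ ≤ ∫⁻ t in Ioc 0 L, ‖fderiv ℝ φ (x + t • e) e‖ₑ := by
  have hc : Continuous fun t : ℝ => fderiv ℝ φ (x + t • e) e :=
    ((hφ.continuous_fderiv (by simp)).comp (by fun_prop)).clm_apply continuous_const
  have hder : ∀ t ∈ uIcc 0 L,
      HasDerivAt (fun t : ℝ => φ (x + t • e)) (fderiv ℝ φ (x + t • e) e) t := by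
    intro t _
    have h1 : HasFDerivAt φ (fderiv ℝ φ (x + t • e)) (x + t • e) :=
      (hφ.differentiable (by simp) _).hasFDerivAt
    have h2 : HasDerivAt (fun t : ℝ => x + t • e) e t := by
      simpa using ((hasDerivAt_id t).smul_const e).const_add x
    exact h1.comp_hasDerivAt t h2
  have hftc := intervalIntegral.integral_eq_sub_of_hasDerivAt hder (hc.intervalIntegrable _ _)
  simp only [h0, zero_smul, add_zero, zero_sub] at hftc
  rw [← enorm_neg (φ x), ← hftc, intervalIntegral.integral_of_le hL]
  exact enorm_integral_le_lintegral_enorm _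

/-- Poincaré inequality for smooth functions with support in a ball. -/
theorem lintegral_enorm_rpow_le_fderiv {x₀ : Vec n} {ρ : ℝ} (hρ : 0 < ρ)
    {p : ℝ≥0∞} [hp1 : Fact (1 ≤ p)] (hp : p ≠ ⊤) {φ : Vec n → Vec N}
    (hφ : IsTest (Metric.ball x₀ ρ) φ) {e : Vec n} (he : ‖e‖ = 1) :
    ∫⁻ x in Metric.ball x₀ ρ, ‖φ x‖ₑ ^ p.toReal ≤
      ENNReal.ofReal (2 * ρ) ^ p.toReal *
        ∫⁻ x in Metric.ball x₀ ρ, ‖fderiv ℝ φ x e‖ₑ ^ p.toReal := by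
  have hp0 : p ≠ 0 := (zero_lt_one.trans_le hp1.out).ne'
  have hq : 0 < p.toReal := ENNReal.toReal_pos hp0 hp
  have hq1 : 1 ≤ p.toReal := by simpa using ENNReal.toReal_mono hp hp1.out
  set ψ : Vec n → Vec N := fun x => fderiv ℝ φ x e with hψ
  have hψc : Continuous ψ := (hφ.1.continuous_fderiv (by simp)).clm_apply continuous_const
  have hψ0 : ∀ x, x ∉ Metric.ball x₀ ρ → ψ x = 0 := fun x hx => by
    have : fderiv ℝ φ x = 0 := image_eq_zero_of_notMem_tsupport fun h =>
      hx (hφ.2.2 (tsupport_fderiv_subset ℝ h))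
    simp [hψ, this]
  set L := 2 * ρ with hL
  have hL0 : 0 ≤ L := by positivity
  have hLpos : ENNReal.ofReal L ≠ 0 := by simp [hL, hρ]
  set ν : Measure ℝ := volume.restrict (Ioc 0 L) with hν
  have hνu : ν univ = ENNReal.ofReal L := by simp [hν]
  have hpt : ∀ x ∈ Metric.ball x₀ ρ, ‖φ x‖ₑ ^ p.toReal ≤
      ENNReal.ofReal L ^ (p.toReal - 1) * ∫⁻ t, ‖ψ (x + t • e)‖ₑ ^ p.toReal ∂ν := by
    intro x hx
    -- A step of length `2 * ρ`, the diameter, leaves the open ball.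
    have hout : φ (x + L • e) = 0 := by
      refine image_eq_zero_of_notMem_tsupport fun h => ?_
      have h1 := hφ.2.2 h
      rw [Metric.mem_ball, dist_eq_norm] at h1 hx
      have h2 : ‖L • e‖ ≤ ‖x + L • e - x₀‖ + ‖x - x₀‖ := by
        have : (x + L • e - x₀) - (x - x₀) = L • e := by abel
        have h := norm_sub_le (x + L • e - x₀) (x - x₀)
        rwa [this] at h
      rw [norm_smul, he, Real.norm_of_nonneg hL0] at h2
      linarith
    have h1 := enorm_le_lintegral_fderiv (hφ.1.of_le (by simp)) x e hL0 hout
    have hm : AEStronglyMeasurable (fun t : ℝ => ψ (x + t • e)) ν :=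
      (hψc.comp (by fun_prop)).aestronglyMeasurable
    -- Hölder's inequality on the segment, whose total mass is `L`.
    have h2 := eLpNorm_le_eLpNorm_mul_rpow_measure_univ hp1.out hm
    rw [eLpNorm_one_eq_lintegral_enorm, eLpNorm_eq_lintegral_rpow_enorm_toReal hp0 hp, hνu] at h2
    calc ‖φ x‖ₑ ^ p.toReal ≤ ((∫⁻ t, ‖ψ (x + t • e)‖ₑ ^ p.toReal ∂ν) ^ (1 / p.toReal) *
          ENNReal.ofReal L ^ (1 / (1 : ℝ≥0∞).toReal - 1 / p.toReal)) ^ p.toReal :=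
          ENNReal.rpow_le_rpow (h1.trans h2) hq.le
      _ = _ := by
          rw [ENNReal.mul_rpow_of_nonneg _ _ hq.le, ← ENNReal.rpow_mul, ← ENNReal.rpow_mul,
            one_div_mul_cancel hq.ne', ENNReal.rpow_one, mul_comm]
          congr 2
          simp
          field_simp
  have hmeas : AEMeasurable (Function.uncurry fun (x : Vec n) (t : ℝ) =>
      ‖ψ (x + t • e)‖ₑ ^ p.toReal) ((volume : Measure (Vec n)).prod ν) := by
    have : Continuous fun z : Vec n × ℝ => ψ (z.1 + z.2 • e) := hψc.comp (by fun_prop)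
    exact (this.enorm.measurable.pow_const _).aemeasurable
  have hcoef : ENNReal.ofReal L ^ (p.toReal - 1) ≠ ⊤ :=
    ENNReal.rpow_ne_top_of_nonneg (by linarith) (by simp)
  calc ∫⁻ x in Metric.ball x₀ ρ, ‖φ x‖ₑ ^ p.toReal
      ≤ ∫⁻ x in Metric.ball x₀ ρ, ENNReal.ofReal L ^ (p.toReal - 1) *
          ∫⁻ t, ‖ψ (x + t • e)‖ₑ ^ p.toReal ∂ν :=
        setLIntegral_mono' measurableSet_ball hpt
    _ ≤ ∫⁻ x, ENNReal.ofReal L ^ (p.toReal - 1) * ∫⁻ t, ‖ψ (x + t • e)‖ₑ ^ p.toReal ∂ν :=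
        setLIntegral_le_lintegral _ _
    _ = ENNReal.ofReal L ^ (p.toReal - 1) * ∫⁻ t, (∫⁻ x, ‖ψ (x + t • e)‖ₑ ^ p.toReal) ∂ν := by
        rw [lintegral_const_mul' _ _ hcoef, lintegral_lintegral_swap hmeas]
    _ = ENNReal.ofReal L ^ (p.toReal - 1) * (ENNReal.ofReal L * ∫⁻ x, ‖ψ x‖ₑ ^ p.toReal) := by
        congr 1
        -- After Tonelli, translation invariance makes the inner integral independent of `t`; this
        -- is why `x` was allowed to range over the whole space.
        simp only [lintegral_add_right_eq_self (fun x => ‖ψ x‖ₑ ^ p.toReal)]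
        rw [lintegral_const, hνu, mul_comm]
    _ = ENNReal.ofReal L ^ p.toReal * ∫⁻ x in Metric.ball x₀ ρ, ‖ψ x‖ₑ ^ p.toReal := by
        rw [setLIntegral_eq_of_support_subset, ← mul_assoc]
        · congr 1
          nth_rw 2 [← ENNReal.rpow_one (ENNReal.ofReal L)]
          rw [← ENNReal.rpow_add _ _ hLpos (by simp), sub_add_cancel]
        · intro x hx
          by_contra h
          simp [hψ0 x h, ENNReal.zero_rpow_of_pos hq] at hx

/-- The derivative in one coordinate direction `j` is a column of the gradient matrix, hence
dominated by its Euclidean norm. -/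
theorem poincare_testSubmodule {x₀ : Vec n} {ρ : ℝ} (hρ : 0 < ρ) (j : Fin n)
    {p : ℝ≥0∞} [hp1 : Fact (1 ≤ p)] (hp : p ≠ ⊤) {w : W1p N (Metric.ball x₀ ρ) p}
    (hw : w ∈ testSubmodule N (Metric.ball x₀ ρ) p) : ‖w.1.1‖ ≤ 2 * ρ * ‖w.1.2‖ := by
  obtain ⟨φ, hφ, hwφ⟩ := hw
  have hp0 : p ≠ 0 := (zero_lt_one.trans_le hp1.out).ne'
  have hq : 0 < p.toReal := ENNReal.toReal_pos hp0 hp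
  have hgrad : ∀ᵐ x ∂(volume.restrict (Metric.ball x₀ ρ)),
      ‖fderiv ℝ φ x (EuclideanSpace.single j 1)‖ ≤ ‖w.1.2 x‖ := by
    have := ae_all_iff.2 fun i => weakGrad_ae_eq_fderiv Metric.isOpen_ball w hφ hwφ i j
    filter_upwards [this] with x hx
    rw [EuclideanSpace.norm_eq, EuclideanSpace.norm_eq]
    refine Real.sqrt_le_sqrt ?_
    rw [Fintype.sum_prod_type]
    refine Finset.sum_le_sum fun i _ => ?_
    rw [← hx i]
    exact Finset.single_le_sum (f := fun j => ‖w.1.2 x (i, j)‖ ^ 2) (fun _ _ => by positivity)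
      (Finset.mem_univ j)
  have h := lintegral_enorm_rpow_le_fderiv hρ hp hφ (e := EuclideanSpace.single j 1) (by simp)
  have h' : ‖w.1.1‖ₑ ^ p.toReal ≤ (ENNReal.ofReal (2 * ρ) * ‖w.1.2‖ₑ) ^ p.toReal := by
    rw [ENNReal.mul_rpow_of_nonneg _ _ hq.le, ← lintegral_rpow_enorm_eq hp,
      ← lintegral_rpow_enorm_eq hp]
    refine le_trans (le_of_eq ?_) (h.trans ?_)
    · refine lintegral_congr_ae ?_
      filter_upwards [hwφ] with x hx
      rw [hx]
    · gcongr 1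
      refine lintegral_mono_ae ?_
      filter_upwards [hgrad] with x hx
      exact ENNReal.rpow_le_rpow (enorm_le_iff_norm_le.2 hx) hq.le
  rw [ENNReal.rpow_le_rpow_iff hq] at h'
  have := ENNReal.toReal_mono (ENNReal.mul_ne_top ENNReal.ofReal_ne_top enorm_ne_top) h'
  simpa [ENNReal.toReal_mul, hρ.le] using this

/-- Poincaré inequality in `W^{1,p}_0` of a ball. -/
theorem poincare_W1p₀ {x₀ : Vec n} {ρ : ℝ} (hρ : 0 < ρ) (j : Fin n)
    {p : ℝ≥0∞} [hp1 : Fact (1 ≤ p)] (hp : p ≠ ⊤) {w : W1p N (Metric.ball x₀ ρ) p}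
    (hw : w ∈ W1p₀ N (Metric.ball x₀ ρ) p) : ‖w.1.1‖ ≤ 2 * ρ * ‖w.1.2‖ := by
  have hclosed : IsClosed {w : W1p N (Metric.ball x₀ ρ) p | ‖w.1.1‖ ≤ 2 * ρ * ‖w.1.2‖} :=
    isClosed_le (by fun_prop) (by fun_prop)
  exact closure_minimal (fun w hw => poincare_testSubmodule hρ j hp hw) hclosed hw

end Poincare

/-! ### From weak convergence of gradients to weak convergence in `W^{1,p}` -/

/-- A bounded functional on a submodule on which a linear map is bounded below factors through
the map. -/
theorem exists_clm_comp_eq {X Z : Type*} [NormedAddCommGroup X] [NormedSpace ℝ X]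
    [NormedAddCommGroup Z] [NormedSpace ℝ Z] (S : Submodule ℝ X) (D : X →ₗ[ℝ] Z) {K : ℝ}
    (hD : ∀ x ∈ S, ‖x‖ ≤ K * ‖D x‖) (ℓ : X →L[ℝ] ℝ) :
    ∃ m : Z →L[ℝ] ℝ, ∀ x ∈ S, m (D x) = ℓ x := by
  have hinj : Function.Injective (D.domRestrict S) := by
    refine (injective_iff_map_eq_zero _).2 fun x hx => Subtype.ext (norm_le_zero_iff.1 ?_)
    have hx' : D x = 0 := hx
    simpa [hx'] using hD x x.2
  set e := LinearEquiv.ofInjective (D.domRestrict S) hinj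
  have he : ∀ x, (e x : Z) = D x := fun x => rfl
  -- On the range of `D` the functional `ℓ ∘ D⁻¹` is bounded by `‖ℓ‖ * K`; Hahn–Banach extends it to
  -- all of `Z`.
  obtain ⟨m, hm, -⟩ := exists_extension_norm_eq (LinearMap.range (D.domRestrict S))
    ((((ℓ : X →ₗ[ℝ] ℝ).domRestrict S).comp (e.symm : _ →ₗ[ℝ] S)).mkContinuous (‖ℓ‖ * K) fun y => by
      obtain ⟨x, rfl⟩ := e.surjective y
      simp only [LinearMap.comp_apply, LinearEquiv.coe_coe, LinearEquiv.symm_apply_apply,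
        LinearMap.domRestrict_apply, ContinuousLinearMap.coe_coe]
      refine (ℓ.le_opNorm x).trans ?_
      rw [mul_assoc]
      exact mul_le_mul_of_nonneg_left (hD x x.2) (norm_nonneg _))
  refine ⟨m, fun x hx => ?_⟩
  have h := hm (e ⟨x, hx⟩)
  rw [he] at h
  rw [h]
  simp

variable {n N : ℕ}

/-- The gradient as a linear map on `W^{1,p}`. -/
def gradₗ (N : ℕ) (Ω : Set (Vec n)) (p : ℝ≥0∞) [Fact (1 ≤ p)] :
    W1p N Ω p →ₗ[ℝ] Lp (Mat N n) p (volume.restrict Ω) :=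
  (LinearMap.snd ℝ (Lp (Vec N) p (volume.restrict Ω))
    (Lp (Mat N n) p (volume.restrict Ω))).comp (W1p N Ω p).subtype

theorem midpoint_mem_dirichletClass {Ω : Set (Vec n)} {p : ℝ≥0∞} [Fact (1 ≤ p)] {u v : W1p N Ω p}
    (hv : v ∈ dirichletClass u) : (2⁻¹ : ℝ) • (v + u) ∈ dirichletClass u := by
  have hmid : ∀ {X : Type _} [AddCommGroup X] [Module ℝ X] (a b : X),
      (2⁻¹ : ℝ) • (a + b) - b = (2⁻¹ : ℝ) • (a - b) := fun a b => by module
  change (2⁻¹ : ℝ) • (v + u) - u ∈ W1p₀ N Ω p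
  rw [hmid]
  exact Submodule.smul_mem _ _ hv

/-- In a ball, a sequence in a Dirichlet class converges weakly in `W^{1,p}`, `1 < p < ∞`, as soon
as the gradients are bounded in `L^p` and converge almost everywhere. -/
theorem weaklyConverges_of_ae_tendsto_grad {x₀ : Vec n} {ρ : ℝ} (hρ : 0 < ρ) (j : Fin n)
    {p : ℝ≥0∞} [Fact (1 ≤ p)] (hp1 : 1 < p) (hp : p ≠ ⊤) {u : W1p N (Metric.ball x₀ ρ) p}
    {v : ℕ → W1p N (Metric.ball x₀ ρ) p} (hv : ∀ k, v k ∈ dirichletClass u) {C : ℝ}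
    (hC : ∀ k, ‖(v k).1.2‖ ≤ C)
    (hae : ∀ᵐ x ∂(volume.restrict (Metric.ball x₀ ρ)),
      Tendsto (fun k => (v k).1.2 x) atTop (𝓝 (u.1.2 x))) :
    WeaklyConverges v u := by
  intro ℓ
  have hD : ∀ w ∈ W1p₀ N (Metric.ball x₀ ρ) p,
      ‖w‖ ≤ max (2 * ρ) 1 * ‖gradₗ N (Metric.ball x₀ ρ) p w‖ := by
    intro w hw
    change max ‖w.1.1‖ ‖w.1.2‖ ≤ max (2 * ρ) 1 * ‖w.1.2‖
    refine max_le ((poincare_W1p₀ hρ j hp hw).trans ?_) ?_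
    · gcongr
      exact le_max_left _ _
    · exact le_mul_of_one_le_left (norm_nonneg _) (le_max_right _ _)
  -- Poincaré's inequality makes the gradient bounded below on `W1p₀`, which contains every `v k -
  -- u`.
  obtain ⟨m, hm⟩ := exists_clm_comp_eq _ _ hD ℓ
  have hm' : ∀ k, m ((v k).1.2 - u.1.2) = ℓ (v k) - ℓ u := by
    intro k
    rw [← map_sub ℓ]
    exact hm (v k - u) (hv k)
  have hlim : Tendsto (fun k => m ((v k).1.2 - u.1.2)) atTop (𝓝 0) := by
    refine tendsto_clm_of_ae_tendsto_zero hp1 hp (C := C + ‖u.1.2‖)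
      (fun k => (norm_sub_le _ _).trans (by gcongr; exact hC k)) ?_ m
    have hsub : ∀ᵐ x ∂(volume.restrict (Metric.ball x₀ ρ)), ∀ k,
        ((v k).1.2 - u.1.2) x = (v k).1.2 x - u.1.2 x := by
      rw [ae_all_iff]
      exact fun k => Lp.coeFn_sub _ _
    filter_upwards [hae, hsub] with x hx hs
    simp only [hs]
    simpa using hx.sub_const (u.1.2 x)
  simp only [hm'] at hlim
  simpa using hlim.add_const (ℓ u)

/-! ### Coercivity and minimizing sequences -/

section Energy

variable {Ω : Set (Vec n)} {p : ℝ≥0∞} [Fact (1 ≤ p)] {f : Vec n → Mat N n → ℝ}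

/-- Coercivity bounds the `L^p` norm of the gradient by the energy. -/
theorem enorm_grad_rpow_le (hΩ : MeasurableSet Ω) (hp : p ≠ ⊤) {c : ℝ} (hc : 0 < c)
    (hcoer : ∀ x ∈ Ω, ∀ z, c * (‖z‖ ^ p.toReal - 1) ≤ f x z) (v : W1p N Ω p) :
    ENNReal.ofReal c * ‖v.1.2‖ₑ ^ p.toReal ≤ energy f v + ENNReal.ofReal c * volume Ω := by
  have hmain : ∀ x ∈ Ω, ENNReal.ofReal c * ‖v.1.2 x‖ₑ ^ p.toReal ≤
      ENNReal.ofReal (f x (v.1.2 x)) + ENNReal.ofReal c := by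
    intro x hx
    rw [← ofReal_norm, ENNReal.ofReal_rpow_of_nonneg (norm_nonneg _) ENNReal.toReal_nonneg,
      ← ENNReal.ofReal_mul hc.le]
    refine (ENNReal.ofReal_le_ofReal ?_).trans ENNReal.ofReal_add_le
    have := hcoer x hx (v.1.2 x)
    linarith
  calc ENNReal.ofReal c * ‖v.1.2‖ₑ ^ p.toReal
      = ∫⁻ x in Ω, ENNReal.ofReal c * ‖v.1.2 x‖ₑ ^ p.toReal := by
        rw [lintegral_const_mul' _ _ ENNReal.ofReal_ne_top, lintegral_rpow_enorm_eq hp]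
    _ ≤ ∫⁻ x in Ω, (ENNReal.ofReal (f x (v.1.2 x)) + ENNReal.ofReal c) :=
        setLIntegral_mono' hΩ hmain
    _ = _ := by
        rw [lintegral_add_right _ measurable_const, setLIntegral_const]
        rfl

/-- The integral of the midpoint convexity gap is the midpoint convexity gap of the energy. -/
theorem lintegral_midpoint_gap_add_energy (hΩ : MeasurableSet Ω)
    (hmeas : ∀ z, AEMeasurable (fun x => f x z) (volume.restrict Ω))
    (hnonneg : ∀ x ∈ Ω, ∀ z, 0 ≤ f x z) (hconv : ∀ x ∈ Ω, ConvexOn ℝ univ (f x))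
    (v u : W1p N Ω p) :
    (∫⁻ x in Ω, ENNReal.ofReal (2⁻¹ * (f x (v.1.2 x) + f x (u.1.2 x)) -
        f x ((2⁻¹ : ℝ) • (v.1.2 x + u.1.2 x)))) + energy f ((2⁻¹ : ℝ) • (v + u))
      = 2⁻¹ * (energy f v + energy f u) := by
  have hcont : ∀ᵐ x ∂(volume.restrict Ω), Continuous (f x) := by
    filter_upwards [ae_restrict_mem hΩ] with x hx
    exact continuousOn_univ.1 ((hconv x hx).continuousOn isOpen_univ)
  have hm : ∀ w : W1p N Ω p, AEMeasurable (fun x => ENNReal.ofReal (f x (w.1.2 x)))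
      (volume.restrict Ω) := fun w =>
    (aemeasurable_caratheodory hmeas hcont (Lp.aestronglyMeasurable w.1.2)).ennreal_ofReal
  have hmid : ∀ᵐ x ∂(volume.restrict Ω), ((2⁻¹ : ℝ) • (v + u)).1.2 x =
      (2⁻¹ : ℝ) • (v.1.2 x + u.1.2 x) := by
    filter_upwards [Lp.coeFn_smul (2⁻¹ : ℝ) (v.1.2 + u.1.2), Lp.coeFn_add v.1.2 u.1.2] with x h1 h2
    have : ((2⁻¹ : ℝ) • (v + u)).1.2 x = ((2⁻¹ : ℝ) • (v.1.2 + u.1.2)) x := rfl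
    rw [this, h1, Pi.smul_apply, h2, Pi.add_apply]
  unfold energy
  rw [← lintegral_add_right' _ (hm _), ← lintegral_add_right' _ (hm _),
    ← lintegral_const_mul' _ _ (by simp)]
  refine lintegral_congr_ae ?_
  filter_upwards [hmid, ae_restrict_mem hΩ] with x hx hxΩ
  have hgap := (hconv x hxΩ).midpoint_gap_nonneg (v.1.2 x) (u.1.2 x)
  rw [hx, ← ENNReal.ofReal_add hgap (hnonneg x hxΩ _), sub_add_cancel,
    ← ENNReal.ofReal_add (hnonneg x hxΩ _) (hnonneg x hxΩ _), ENNReal.ofReal_mul (by norm_num),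
    ENNReal.ofReal_inv_of_pos (by norm_num)]
  simp

/-- The gradients of a fast minimizing sequence of a strictly convex energy converge to the gradient
of the minimizer almost everywhere. -/
theorem ae_tendsto_grad_of_minimizing (hΩ : MeasurableSet Ω)
    (hmeas : ∀ z, AEMeasurable (fun x => f x z) (volume.restrict Ω))
    (hnonneg : ∀ x ∈ Ω, ∀ z, 0 ≤ f x z) (hconv : ∀ x ∈ Ω, StrictConvexOn ℝ univ (f x))
    {u : W1p N Ω p} (hfin : energy f u < ⊤) (hmin : ∀ v ∈ dirichletClass u, energy f u ≤ energy f v)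
    {v : ℕ → W1p N Ω p} (hv : ∀ k, v k ∈ dirichletClass u)
    (hlt : ∀ k, energy f (v k) ≤ energy f u + 2⁻¹ ^ k) :
    ∀ᵐ x ∂(volume.restrict Ω), Tendsto (fun k => (v k).1.2 x) atTop (𝓝 (u.1.2 x)) := by
  have hcont : ∀ᵐ x ∂(volume.restrict Ω), Continuous (f x) := by
    filter_upwards [ae_restrict_mem hΩ] with x hx
    exact continuousOn_univ.1 ((hconv x hx).convexOn.continuousOn isOpen_univ)
  set h : ℕ → Vec n → ℝ := fun k x => 2⁻¹ * (f x ((v k).1.2 x) + f x (u.1.2 x)) -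
        f x ((2⁻¹ : ℝ) • ((v k).1.2 x + u.1.2 x)) with hh
  have hhm : ∀ k, AEMeasurable (fun x => ENNReal.ofReal (h k x)) (volume.restrict Ω) := by
    intro k
    have h1 := aemeasurable_caratheodory hmeas hcont (Lp.aestronglyMeasurable (v k).1.2)
    have h2 := aemeasurable_caratheodory hmeas hcont (Lp.aestronglyMeasurable u.1.2)
    have h3 := aemeasurable_caratheodory hmeas hcont
      (((Lp.aestronglyMeasurable (v k).1.2).add (Lp.aestronglyMeasurable u.1.2)).const_smul
        (2⁻¹ : ℝ))
    exact (((h1.add h2).const_mul 2⁻¹).sub h3).ennreal_ofReal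
  have hint : ∀ k, ∫⁻ x in Ω, ENNReal.ofReal (h k x) ≤ 2⁻¹ ^ k := by
    intro k
    have hmem := midpoint_mem_dirichletClass (hv k)
    have heq := lintegral_midpoint_gap_add_energy hΩ hmeas hnonneg
      (fun x hx => (hconv x hx).convexOn) (v k) u
    -- Adding the finite energy of `u` to both sides avoids subtraction in `ℝ≥0∞`.
    refine (ENNReal.add_le_add_iff_right hfin.ne).1 ?_
    calc (∫⁻ x in Ω, ENNReal.ofReal (h k x)) + energy f u
        ≤ (∫⁻ x in Ω, ENNReal.ofReal (h k x)) + energy f ((2⁻¹ : ℝ) • (v k + u)) := by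
          gcongr
          exact hmin _ hmem
      _ = 2⁻¹ * (energy f (v k) + energy f u) := heq
      _ ≤ 2⁻¹ * ((energy f u + 2⁻¹ ^ k) + (energy f u + 2⁻¹ ^ k)) := by
          gcongr
          · exact hlt k
          · exact le_self_add
      _ = 2⁻¹ ^ k + energy f u := by
          rw [← two_mul, ← mul_assoc, ENNReal.inv_mul_cancel (by simp) (by simp), one_mul, add_comm]
  -- Summability of `2⁻¹ ^ k` makes the series of gaps finite almost everywhere, so its terms tend
  -- to `0` with no passage to a subsequence.
  have hsum : ∫⁻ x in Ω, ∑' k, ENNReal.ofReal (h k x) ≠ ⊤ := by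
    rw [lintegral_tsum hhm]
    refine ne_top_of_le_ne_top ?_ (ENNReal.tsum_le_tsum hint)
    rw [ENNReal.tsum_geometric]
    simp
  have hsumm : AEMeasurable (fun x => ∑' k, ENNReal.ofReal (h k x)) (volume.restrict Ω) :=
    AEMeasurable.tsum hhm
  filter_upwards [ae_lt_top' hsumm hsum, ae_restrict_mem hΩ] with x hx hxΩ
  refine (hconv x hxΩ).tendsto_of_midpoint_gap ?_
  have hnn : ∀ k, 0 ≤ h k x := fun k =>
    (hconv x hxΩ).convexOn.midpoint_gap_nonneg ((v k).1.2 x) (u.1.2 x)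
  have h0 := ENNReal.tendsto_atTop_zero_of_tsum_ne_top hx.ne
  have h1 := (ENNReal.tendsto_toReal (by simp : (0 : ℝ≥0∞) ≠ ⊤)).comp h0
  refine (h1.congr fun k => ?_)
  exact ENNReal.toReal_ofReal (hnn k)

end Energy

end CalcVar

end

/-! ### Energy approximation -/

theorem theorem3 (n N : ℕ) (hn : 2 ≤ n) (hN : 1 ≤ N)
    (x₀ : CalcVar.Vec n) (ρ : ℝ) (hρ : 0 < ρ)
    (p : ℝ≥0∞) [Fact (1 ≤ p)] (hp1 : 1 < p) (hp : p ≠ ⊤)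
    (f : CalcVar.Vec n → CalcVar.Mat N n → ℝ)
    (hmeas : ∀ z, AEMeasurable (fun x => f x z) (volume.restrict (Metric.ball x₀ ρ)))
    (hnonneg : ∀ x ∈ Metric.ball x₀ ρ, ∀ z, 0 ≤ f x z)
    (hconv : ∀ x ∈ Metric.ball x₀ ρ, StrictConvexOn ℝ univ (f x))
    (c : ℝ) (hc : 0 < c)
    (hcoer : ∀ x ∈ Metric.ball x₀ ρ, ∀ z, c * (‖z‖ ^ p.toReal - 1) ≤ f x z)
    (u : CalcVar.W1p N (Metric.ball x₀ ρ) p)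
    (hfin : CalcVar.energy f u < ⊤)
    (hmin : CalcVar.energy f u = ⨅ v ∈ CalcVar.dirichletClass u, CalcVar.energy f v)
    (Y : Set (CalcVar.W1p N (Metric.ball x₀ ρ) p)) :
    CalcVar.NoLavrentiev f u Y → CalcVar.EnergyApprox f u Y := by
  intro hY
  have hq : 0 < p.toReal := ENNReal.toReal_pos (zero_lt_one.trans hp1).ne' hp
  have hmin' : ∀ v ∈ CalcVar.dirichletClass u, CalcVar.energy f u ≤ CalcVar.energy f v :=
    fun v hv => hmin.le.trans (iInf₂_le v hv)
  have hex : ∀ k : ℕ, ∃ v ∈ CalcVar.dirichletClass u ∩ Y,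
      CalcVar.energy f v < CalcVar.energy f u + 2⁻¹ ^ k := by
    intro k
    have h1 : (⨅ v ∈ CalcVar.dirichletClass u ∩ Y, CalcVar.energy f v) <
        CalcVar.energy f u + 2⁻¹ ^ k := by
      rw [← hY, ← hmin]
      exact ENNReal.lt_add_right hfin.ne (by simp)
    obtain ⟨v, hv⟩ := iInf_lt_iff.1 h1
    obtain ⟨hvm, hv⟩ := iInf_lt_iff.1 hv
    exact ⟨v, hvm, hv⟩
  choose v hvm hvlt using hex
  have hv : ∀ k, v k ∈ CalcVar.dirichletClass u := fun k => (hvm k).1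
  refine ⟨v, fun k => (hvm k).2, ?_, ?_⟩
  · have hae := CalcVar.ae_tendsto_grad_of_minimizing measurableSet_ball hmeas hnonneg hconv
      hfin hmin' hv fun k => (hvlt k).le
    -- Coercivity solved for the `p`-th power of the gradient norm; the `1` bounds every `2⁻¹ ^ k`.
    set A : ℝ≥0∞ := (ENNReal.ofReal c)⁻¹ *
      (CalcVar.energy f u + 1 + ENNReal.ofReal c * volume (Metric.ball x₀ ρ)) with hA
    have hc0 : ENNReal.ofReal c ≠ 0 := by simpa using hc
    have hAtop : A ≠ ⊤ := by
      refine ENNReal.mul_ne_top (by simpa using hc) (ENNReal.add_ne_top.2 ⟨?_, ?_⟩)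
      · exact ENNReal.add_ne_top.2 ⟨hfin.ne, by simp⟩
      · exact ENNReal.mul_ne_top ENNReal.ofReal_ne_top measure_ball_lt_top.ne
    have hbound : ∀ k, ‖(v k).1.2‖ ≤ (A ^ p.toReal⁻¹).toReal := by
      intro k
      have h1 := CalcVar.enorm_grad_rpow_le measurableSet_ball hp hc hcoer (v k)
      have h2 : ENNReal.ofReal c * ‖(v k).1.2‖ₑ ^ p.toReal ≤
          CalcVar.energy f u + 1 + ENNReal.ofReal c * volume (Metric.ball x₀ ρ) := by
        refine h1.trans ?_
        gcongr
        refine (hvlt k).le.trans ?_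
        gcongr
        exact pow_le_one₀ (by simp) (by simp)
      have h3 : ‖(v k).1.2‖ₑ ^ p.toReal ≤ A := by
        rw [hA, ← ENNReal.div_eq_inv_mul,
          ENNReal.le_div_iff_mul_le (Or.inl hc0) (Or.inl ENNReal.ofReal_ne_top), mul_comm]
        exact h2
      have h4 := (ENNReal.le_rpow_inv_iff hq).2 h3
      simpa using ENNReal.toReal_mono
        (ENNReal.rpow_ne_top_of_nonneg (inv_nonneg.2 hq.le) hAtop) h4
    -- Any coordinate direction serves for Poincaré's inequality; `2 ≤ n` ensures that index `0`
    -- exists.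
    exact CalcVar.weaklyConverges_of_ae_tendsto_grad hρ ⟨0, by omega⟩ hp1 hp hv hbound hae
  · refine tendsto_of_tendsto_of_tendsto_of_le_of_le tendsto_const_nhds ?_
      (fun k => hmin' _ (hv k)) (fun k => (hvlt k).le)
    have h1 : Tendsto (fun k : ℕ => (2⁻¹ : ℝ≥0∞) ^ k) atTop (𝓝 0) :=
      ENNReal.tendsto_pow_atTop_nhds_zero_of_lt_one (by simp)
    simpa using h1.const_add (CalcVar.energy f u)
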